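/- Let $(\mathcal X,d)$ be a proper metric space (closed balls are compact), let $N\ge 1$, let $\lambda=(\lambda_1,\dots,\lambda_N)$ satisfy $\lambda_i\ge 0$ and $\sum_{i=1}^N\lambda_i=1$, and let $\nu_1,\dots,\nu_N\in\mathcal P_1(\mathcal X)$, where $\mathcal P_1(\mathcal Y)$ denotes the set of Borel probability measures on a metric space $\mathcal Y$ with finite first moment. For $\mu,\nu\in\mathcal P_1(\mathcal X)$ let $\Pi(\mu,\nu)$ be the set of Borel probability measures on $\mathcal X^2$ with marginals $\mu$ and $\nu$ (transport plans), and $W_1(\mu,\nu)=\inf_{\gamma\in\Pi(\mu,\nu)}\int d(x,y)\,d\gamma(x,y)$; a plan attaining this infimum is called optimal. Let $\Pi(\nu_1,\dots,\nu_N)$ be the set of Borel probability measures on $\mathcal X^N$ whose $i$-th marginal is $\nu_i$ for each $i$. Put $$f_\lambda(x,x_1,\dots,x_N)=\sum_{i=1}^N\lambda_i d(x_i,x),\qquad c_\lambda(x_1,\dots,x_N)=\min_{y\in\mathcal X}f_\lambda(y,x_1,\dots,x_N),$$ $$\mathsf M_\lambda(x_1,\dots,x_N)=\operatorname*{argmin}_{y\in\mathcal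 X}f_\lambda(y,x_1,\dots,x_N).$$ On $\mathcal X^{N+1}$, with points written $(x,x_1,\dots,x_N)$, let $\pi_0$, $\pi_{0,j}$ and $\pi_{1,\dots,N}$ be the projections to $x$, to $(x,x_j)$ and to $(x_1,\dots,x_N)$. Consider the problems $$\text{(A)}\quad \inf_{\mu\in\mathcal P_1(\mathcal X)}\sum_{i=1}^N\lambda_iW_1(\nu_i,\mu),$$ $$\text{(B)}\quad \inf\Big\{\int_{\mathcal X^{N+1}}f_\lambda\,d\theta:\ \theta\in\mathcal P_1(\mathcal X^{N+1}),\ (\pi_{1,\dots,N})_\#\theta\in\Pi(\nu_1,\dots,\nu_N)\Big\},$$ $$\text{(C)}\quad \inf_{\gamma\in\Pi(\nu_1,\dots,\nu_N)}\int_{\mathcal X^N}c_\lambda\,d\gamma,$$ and let $\operatorname{Med}_\lambda(\nu_1,\dots,\nu_N)$ be the set of solutions of (A) (the Wasserstein medians). Then: 1. The infima in (A), (B) and (C) are attained, finite and equal. 2. If $\nu\in\operatorname{Med}_\lambda(\nu_1,\dots,\nu_N)$, then there is a solution $\theta$ of (B) with $\nu=(\pi_0)_\#\theta$. Conversely, if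 $\theta$ solves (B), then $(\pi_0)_\#\theta\in\operatorname{Med}_\lambda(\nu_1,\dots,\nu_N)$. 3. If $\theta$ solves (B) and $\nu=(\pi_0)_\#\theta$, then for every $j$ with $\lambda_j>0$ the measure $(\pi_{0,j})_\#\theta$ is an optimal transport plan between $\nu$ and $\nu_j$. 4. If $\mathsf m:\mathcal X^N\to\mathcal X$ is Borel with $\mathsf m(x_1,\dots,x_N)\in\mathsf M_\lambda(x_1,\dots,x_N)$ for all $(x_1,\dots,x_N)$, and $\gamma$ solves (C), then $\mathsf m_\#\gamma\in\operatorname{Med}_\lambda(\nu_1,\dots,\nu_N)$. 5. A Borel measure $\nu$ on $\mathcal X$ belongs to $\operatorname{Med}_\lambda(\nu_1,\dots,\nu_N)$ if and only if there exist a solution $\gamma$ of (C) and a Borel family of probability measures $\theta^{x_1,\dots,x_N}$ on $\mathcal X$ such that $\theta^{x_1,\dots,x_N}$ is supported on $\mathsf M_\lambda(x_1,\dots,x_N)$ for $\gamma$-a.e. $(x_1,\dots,x_N)$ and $\nu=(\pi_0)_\#(\theta^{x_1,\dots,x_N}\otimes\gamma)$, where $\theta^{x_1,\dots,x_N}\otimes\gamma$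 is the measure on $\mathcal X^{N+1}$ under which $(x_1,\dots,x_N)$ has law $\gamma$ and $x$ has conditional law $\theta^{x_1,\dots,x_N}$. -/

import Mathlib

open MeasureTheory ProbabilityTheory
open scoped NNReal ENNReal

noncomputable section

namespace WassersteinMedian

/-- `𝒫₁(Y)`: the Borel probability measures `μ` on the metric space `Y` with finite first moment,
i.e. `d(y₀, ·) ∈ L¹(μ)` for some (equivalently, for all) `y₀`. On a finite product of metric spaces
the distance is the sup distance; any other usual product distance gives the same set. -/
def P1 (Y : Type*) [PseudoMetricSpace Y] [MeasurableSpace Y] : Set (Measure Y) :=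
  {μ | IsProbabilityMeasure μ ∧ ∃ y₀ : Y, Integrable (fun y => dist y₀ y) μ}

section Transport

variable {X : Type*} [MetricSpace X] [MeasurableSpace X]

/-- `Π(μ, ν)`: transport plans between `μ` and `ν`. -/
def plans (μ ν : Measure X) : Set (Measure (X × X)) :=
  {γ | IsProbabilityMeasure γ ∧ γ.map Prod.fst = μ ∧ γ.map Prod.snd = ν}

/-- The transport cost `∫ d(x, y) dγ(x, y)`. -/
def transportCost (γ : Measure (X × X)) : ℝ≥0∞ :=
  ∫⁻ p, edist p.1 p.2 ∂γ

/-- The Wasserstein distance of order one. -/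
def W1 (μ ν : Measure X) : ℝ≥0∞ :=
  ⨅ γ ∈ plans μ ν, transportCost γ

/-- `γ` is an optimal transport plan between `μ` and `ν`. -/
def IsOptimalPlan (γ : Measure (X × X)) (μ ν : Measure X) : Prop :=
  γ ∈ plans μ ν ∧ IsMinOn transportCost (plans μ ν) γ

end Transport

section Median

variable {X : Type*} [MetricSpace X] [MeasurableSpace X] {N : ℕ}

/-- The weighted dispersion functional `μ ↦ ∑ i, w i * W₁(ν i, μ)`. -/
def dispersion (w : Fin N → ℝ) (ν : Fin N → Measure X) (μ : Measure X) : ℝ≥0∞ :=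
  ∑ i, ENNReal.ofReal (w i) * W1 (ν i) μ

/-- `Med_w(ν₁, …, ν_N)`: the Wasserstein medians, i.e. the minimizers of the dispersion
over `𝒫₁(X)`. -/
def Med (w : Fin N → ℝ) (ν : Fin N → Measure X) : Set (Measure X) :=
  {μ | μ ∈ P1 X ∧ IsMinOn (dispersion w ν) (P1 X) μ}

/-- `f_w(x, x₁, …, x_N) = ∑ i, w i * d(x i, x)`. A point of `X^{N+1}` is written as a pair
`(x, (x₁, …, x_N))`. -/
def f (w : Fin N → ℝ) (p : X × (Fin N → X)) : ℝ :=
  ∑ i, w i * dist (p.2 i) p.1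

/-- `c_w(x₁, …, x_N) = min_y f_w(y, x₁, …, x_N)`. -/
def c (w : Fin N → ℝ) (x : Fin N → X) : ℝ :=
  ⨅ y : X, f w (y, x)

/-- `M_w(x₁, …, x_N)`: the set of minimizers of `y ↦ f_w(y, x₁, …, x_N)`. -/
def M (w : Fin N → ℝ) (x : Fin N → X) : Set X :=
  {y | ∀ z : X, f w (y, x) ≤ f w (z, x)}

/-- `Π(ν₁, …, ν_N)`: probability measures on `X^N` whose `i`-th marginal is `ν i`. -/
def couplings (ν : Fin N → Measure X) : Set (Measure (Fin N → X)) :=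
  {γ | IsProbabilityMeasure γ ∧ ∀ i, γ.map (fun x => x i) = ν i}

/-- Admissible measures of the multi-marginal problem on `X^{N+1}`: `θ ∈ 𝒫₁(X^{N+1})` whose
image under `(x, x₁, …, x_N) ↦ (x₁, …, x_N)` is in `Π(ν₁, …, ν_N)`. -/
def extendedCouplings (ν : Fin N → Measure X) : Set (Measure (X × (Fin N → X))) :=
  {θ | θ ∈ P1 (X × (Fin N → X)) ∧ θ.map Prod.snd ∈ couplings ν}

/-- The objective `∫ f_w dθ` (the integrand is nonnegative for nonnegative weights). -/
def extendedCost (w : Fin N → ℝ) (θ : Measure (X × (Fin N → X))) : ℝ≥0∞ :=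
  ∫⁻ p, ENNReal.ofReal (f w p) ∂θ

/-- The objective `∫ c_w dγ` (the integrand is nonnegative for nonnegative weights). -/
def couplingCost (w : Fin N → ℝ) (γ : Measure (Fin N → X)) : ℝ≥0∞ :=
  ∫⁻ x, ENNReal.ofReal (c w x) ∂γ

/-- `θ` solves the multi-marginal problem on `X^{N+1}`. -/
def SolvesExtended (w : Fin N → ℝ) (ν : Fin N → Measure X)
    (θ : Measure (X × (Fin N → X))) : Prop :=
  θ ∈ extendedCouplings ν ∧ IsMinOn (extendedCost w) (extendedCouplings ν) θ

/-- `γ` solves the multi-marginal problem on `X^N` with cost `c_w`. -/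
def SolvesCoupling (w : Fin N → ℝ) (ν : Fin N → Measure X) (γ : Measure (Fin N → X)) : Prop :=
  γ ∈ couplings ν ∧ IsMinOn (couplingCost w) (couplings ν) γ

/-- The measure `κ^{x₁, …, x_N} ⊗ γ` on `X^{N+1}`, with `(x₁, …, x_N)` distributed according to `γ`
and `x` according to `κ^{x₁, …, x_N}` conditionally on `(x₁, …, x_N)`. -/
def disintegrated (γ : Measure (Fin N → X)) (κ : Kernel (Fin N → X) X) :
    Measure (X × (Fin N → X)) :=
  (γ ⊗ₘ κ).map Prod.swap

end Median

end WassersteinMedian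

end

/-! All three problems are compared through (B). If `θ` is admissible, its projection to `(x, x_i)`
is a plan between its first marginal and `ν i`, so the dispersion of that marginal is at most the
cost of `θ` (`dispersion_map_fst_le`). Conversely, optimal plans from a given `μ` to the `ν i` can
be glued along `μ`, which gives equality (`exists_extendedCost_eq_dispersion`). Hence (A) and (B)
have the same value, and medians are exactly the first marginals of solutions of (B).

Between (B) and (C), one inequality is `c ≤ f`; the other inserts a measurable near-minimizer of `f
w (·, x)` (`extendedCost_le_couplingCost`). Existence is proved by the direct method for (B) only
and then transferred.

The remaining claims are equality cases: equality in the sum of transport costs makes each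
positively weighted projection optimal, and equality in `c ≤ f` concentrates `θ` on pointwise
medians, so that disintegrating `θ` gives the characterization. One positive weight `w j` controls
first moments throughout. -/

namespace WassersteinMedian

/-! ### First moments via extended distances -/

section Moments

variable {Y : Type*} [PseudoMetricSpace Y] [MeasurableSpace Y]

theorem lintegral_edist_ne_top_of_lintegral_edist_ne_top {μ : Measure Y} [IsFiniteMeasure μ]
    {y₀ : Y} (h : ∫⁻ y, edist y₀ y ∂μ ≠ ∞) (y₁ : Y) : ∫⁻ y, edist y₁ y ∂μ ≠ ∞ := by
  refine ne_top_of_le_ne_top ?_ (lintegral_mono fun y => edist_triangle y₁ y₀ y)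
  rw [lintegral_add_left measurable_const, lintegral_const]
  exact ENNReal.add_ne_top.2 ⟨ENNReal.mul_ne_top (edist_ne_top _ _) (measure_ne_top _ _), h⟩

variable [OpensMeasurableSpace Y]

theorem integrable_dist_iff {μ : Measure Y} (y₀ : Y) :
    Integrable (fun y => dist y₀ y) μ ↔ ∫⁻ y, edist y₀ y ∂μ ≠ ∞ := by
  have hm : Measurable fun y => dist y₀ y := (continuous_const.dist continuous_id).measurable
  rw [← lt_top_iff_ne_top]
  simp only [edist_dist]
  exact ⟨fun h => (hasFiniteIntegral_iff_ofReal (ae_of_all _ fun _ => dist_nonneg)).1 h.2,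
    fun h => ⟨hm.aestronglyMeasurable,
      (hasFiniteIntegral_iff_ofReal (ae_of_all _ fun _ => dist_nonneg)).2 h⟩⟩

theorem mem_P1_iff {μ : Measure Y} (y₀ : Y) :
    μ ∈ P1 Y ↔ IsProbabilityMeasure μ ∧ ∫⁻ y, edist y₀ y ∂μ ≠ ∞ := by
  constructor
  · rintro ⟨hμ, y₁, h⟩
    exact ⟨hμ, lintegral_edist_ne_top_of_lintegral_edist_ne_top ((integrable_dist_iff y₁).1 h) y₀⟩
  · rintro ⟨hμ, h⟩
    exact ⟨hμ, y₀, (integrable_dist_iff y₀).2 h⟩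

end Moments

/-! ### Direct method: lower semicontinuity, tightness, closed constraints -/

section Attainment

/-- The truncations `min g n` are bounded and continuous, so their integrals are weakly continuous;
by monotone convergence the integral of `g` is their supremum. -/
theorem lowerSemicontinuous_lintegral {Y : Type*} [TopologicalSpace Y] [MeasurableSpace Y]
    [OpensMeasurableSpace Y] {g : Y → ℝ≥0∞} (hg : Continuous g) :
    LowerSemicontinuous fun μ : ProbabilityMeasure Y => ∫⁻ y, g y ∂(μ : Measure Y) := by
  have hmin : Continuous fun q : ℝ≥0∞ × ℝ≥0 => (min q.1 q.2).toNNReal :=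
    ENNReal.continuousOn_toNNReal.comp_continuous
      (continuous_fst.min (ENNReal.continuous_coe.comp continuous_snd))
      fun q => ne_top_of_le_ne_top ENNReal.coe_ne_top (min_le_right _ _)
  let G (n : ℕ) : BoundedContinuousFunction Y ℝ≥0 :=
    BoundedContinuousFunction.mkOfBound
      ⟨fun y => (min (g y) ((n : ℝ≥0) : ℝ≥0∞)).toNNReal,
        hmin.comp (hg.prodMk continuous_const)⟩ n (by
      intro x y
      have hb : ∀ z, (min (g z) ((n : ℝ≥0) : ℝ≥0∞)).toNNReal ≤ (n : ℝ≥0) := fun z =>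
        ENNReal.coe_le_coe.1 (ENNReal.coe_toNNReal_le_self.trans (min_le_right _ _))
      have hx := NNReal.coe_le_coe.2 (hb x)
      have hy := NNReal.coe_le_coe.2 (hb y)
      rw [NNReal.dist_eq, abs_le]
      simp only [ContinuousMap.coe_mk, NNReal.coe_natCast] at hx hy ⊢
      constructor <;>
        linarith [NNReal.coe_nonneg (min (g x) ((n : ℝ≥0) : ℝ≥0∞)).toNNReal,
          NNReal.coe_nonneg (min (g y) ((n : ℝ≥0) : ℝ≥0∞)).toNNReal])
  have hG : ∀ n y, ((G n y : ℝ≥0) : ℝ≥0∞) = min (g y) n := fun n y =>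
    ENNReal.coe_toNNReal (ne_top_of_le_ne_top ENNReal.coe_ne_top (min_le_right _ _))
  have hsup : ∀ y, ⨆ n : ℕ, min (g y) (n : ℝ≥0∞) = g y := by
    intro y
    rw [← inf_iSup_eq, ENNReal.iSup_natCast, inf_top_eq]
  have key : (fun μ : ProbabilityMeasure Y => ∫⁻ y, g y ∂(μ : Measure Y)) =
      fun μ : ProbabilityMeasure Y => ⨆ n : ℕ, ∫⁻ y, (G n y : ℝ≥0∞) ∂(μ : Measure Y) := by
    ext μ
    simp only [hG]
    rw [← lintegral_iSup (fun n => hg.measurable.min measurable_const)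
      fun a b hab y => min_le_min le_rfl (by exact_mod_cast hab)]
    simp only [hsup]
  rw [key]
  exact lowerSemicontinuous_iSup fun n =>
    (ProbabilityMeasure.continuous_lintegral_boundedContinuousFunction (G n)).lowerSemicontinuous

/-- Markov's inequality bounds the mass outside a closed ball, which is compact by properness. -/
theorem isTightMeasureSet_of_lintegral_edist_le {Y : Type*} [PseudoMetricSpace Y] [ProperSpace Y]
    [MeasurableSpace Y] [OpensMeasurableSpace Y] (y₀ : Y) {D : ℝ≥0∞} (hD : D ≠ ∞)
    {S : Set (Measure Y)} (hS : ∀ μ ∈ S, ∫⁻ y, edist y₀ y ∂μ ≤ D) : IsTightMeasureSet S := by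
  rw [isTightMeasureSet_iff_exists_isCompact_measure_compl_le]
  intro ε hε
  obtain ⟨R, hR⟩ : ∃ R : ℝ≥0, 0 < R ∧ D / R ≤ ε := by
    rcases eq_or_ne ε ∞ with rfl | hε'
    · exact ⟨1, one_pos, le_top⟩
    · have hne : D / ε ≠ ∞ := ENNReal.div_ne_top hD hε.ne'
      -- The added `1` keeps the radius positive when `D = 0`.
      refine ⟨(D / ε).toNNReal + 1, by positivity, ?_⟩
      rw [ENNReal.coe_add, ENNReal.coe_toNNReal hne]
      refine ENNReal.div_le_of_le_mul ?_
      calc D = ε * (D / ε) := (ENNReal.mul_div_cancel hε.ne' hε').symm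
        _ ≤ ε * (D / ε + (1 : ℝ≥0)) := by gcongr; exact le_self_add
  refine ⟨Metric.closedBall y₀ R, isCompact_closedBall _ _, fun μ hμ => ?_⟩
  have hm : Measurable fun y => edist y₀ y := (continuous_const.edist continuous_id).measurable
  calc μ (Metric.closedBall y₀ R)ᶜ ≤ μ {y | (R : ℝ≥0∞) ≤ edist y₀ y} := by
        refine measure_mono fun y hy => ?_
        simp only [Set.mem_compl_iff, Metric.mem_closedBall, not_le] at hy
        rw [Set.mem_ofPred_eq, edist_comm, edist_nndist, ENNReal.coe_le_coe, ← NNReal.coe_le_coe,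
          coe_nndist]
        exact hy.le
    _ ≤ (∫⁻ y, edist y₀ y ∂μ) / R := meas_ge_le_lintegral_div hm.aemeasurable
        (by exact_mod_cast hR.1.ne') ENNReal.coe_ne_top
    _ ≤ D / R := by gcongr; exact hS μ hμ
    _ ≤ ε := hR.2

/-- The direct method for closed sets of probability measures on a proper space, when a sublevel
set of the cost has bounded first moments. -/
theorem exists_isMinOn_lintegral {Y : Type*} [MetricSpace Y] [ProperSpace Y] [MeasurableSpace Y]
    [BorelSpace Y] {K : Set (ProbabilityMeasure Y)} (hK : IsClosed K) {g : Y → ℝ≥0∞}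
    (hg : Continuous g) {μ₀ : ProbabilityMeasure Y} (hμ₀ : μ₀ ∈ K) (y₀ : Y) {D : ℝ≥0∞}
    (hD : D ≠ ∞) (hb : ∀ μ ∈ K, ∫⁻ y, g y ∂(μ : Measure Y) ≤ ∫⁻ y, g y ∂(μ₀ : Measure Y) →
      ∫⁻ y, edist y₀ y ∂(μ : Measure Y) ≤ D) :
    ∃ μ ∈ K, ∀ μ' ∈ K, ∫⁻ y, g y ∂(μ : Measure Y) ≤ ∫⁻ y, g y ∂(μ' : Measure Y) := by
  have hlsc := lowerSemicontinuous_lintegral hg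
  -- Moments are bounded only on this sublevel set. It is closed by lower semicontinuity, hence
  -- compact by Prokhorov.
  set S : Set (ProbabilityMeasure Y) :=
    K ∩ (fun μ : ProbabilityMeasure Y => ∫⁻ y, g y ∂(μ : Measure Y)) ⁻¹'
      Set.Iic (∫⁻ y, g y ∂(μ₀ : Measure Y)) with hS
  have hSc : IsClosed S := hK.inter (hlsc.isClosed_preimage _)
  have hcomp : IsCompact S := by
    rw [← hSc.closure_eq]
    apply isCompact_closure_of_isTightMeasureSet
    apply isTightMeasureSet_of_lintegral_edist_le y₀ hD
    rintro _ ⟨μ, hμ, rfl⟩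
    exact hb μ hμ.1 hμ.2
  obtain ⟨μ, hμ, hmin⟩ := LowerSemicontinuousOn.exists_isMinOn
    (⟨μ₀, hμ₀, le_refl (∫⁻ y, g y ∂(μ₀ : Measure Y))⟩ : S.Nonempty) hcomp
    (hlsc.lowerSemicontinuousOn S)
  refine ⟨μ, hμ.1, fun μ' hμ' => ?_⟩
  rcases le_total (∫⁻ y, g y ∂(μ' : Measure Y)) (∫⁻ y, g y ∂(μ₀ : Measure Y)) with h | h
  · exact hmin ⟨hμ', h⟩
  · exact le_trans hμ.2 h

theorem isClosed_setOf_map_eq {Y Z : Type*} [TopologicalSpace Y] [MeasurableSpace Y]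
    [OpensMeasurableSpace Y] [MetricSpace Z] [MeasurableSpace Z]
    [BorelSpace Z] {φ : Y → Z} (hφ : Continuous φ) (ν : Measure Z) [IsProbabilityMeasure ν] :
    IsClosed {μ : ProbabilityMeasure Y | (μ : Measure Y).map φ = ν} := by
  have h : {μ : ProbabilityMeasure Y | (μ : Measure Y).map φ = ν} =
      (fun μ : ProbabilityMeasure Y => μ.map hφ.measurable.aemeasurable) ⁻¹'
        {(⟨ν, inferInstance⟩ : ProbabilityMeasure Z)} := by
    ext μ
    exact (ProbabilityMeasure.toMeasure_injective.eq_iff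
      (a := μ.map hφ.measurable.aemeasurable) (b := ⟨ν, inferInstance⟩))
  rw [h]
  exact isClosed_singleton.preimage (ProbabilityMeasure.continuous_map hφ)

end Attainment

/-! ### Existence of optimal plans -/

section Plans

variable {X : Type*} [MetricSpace X] [MeasurableSpace X]

theorem map_swap_mem_plans {X : Type*} [MeasurableSpace X] {μ ν : Measure X}
    {γ : Measure (X × X)} (hγ : γ ∈ plans μ ν) :
    γ.map Prod.swap ∈ plans ν μ := by
  obtain ⟨hp, h1, h2⟩ := hγ
  refine ⟨Measure.isProbabilityMeasure_map measurable_swap.aemeasurable, ?_, ?_⟩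
  · rw [Measure.map_map measurable_fst measurable_swap]
    exact h2
  · rw [Measure.map_map measurable_snd measurable_swap]
    exact h1

theorem IsOptimalPlan.transportCost_eq {γ : Measure (X × X)} {μ ν : Measure X}
    (h : IsOptimalPlan γ μ ν) : transportCost γ = W1 μ ν :=
  le_antisymm (le_iInf₂ fun _ hγ' => h.2 hγ') (iInf₂_le γ h.1)

variable [ProperSpace X] [BorelSpace X]

theorem transportCost_map_swap (γ : Measure (X × X)) :
    transportCost (γ.map Prod.swap) = transportCost γ := by
  rw [transportCost, lintegral_map measurable_edist measurable_swap]
  simp only [Prod.fst_swap, Prod.snd_swap, edist_comm]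
  rfl

theorem exists_isOptimalPlan {μ ν : Measure X} (hμ : μ ∈ P1 X) (hν : ν ∈ P1 X) :
    ∃ γ, IsOptimalPlan γ μ ν := by
  have := hμ.1
  have := hν.1
  obtain ⟨x₀⟩ := nonempty_of_isProbabilityMeasure μ
  let K : Set (ProbabilityMeasure (X × X)) :=
    {γ | (γ : Measure (X × X)).map Prod.fst = μ} ∩ {γ | (γ : Measure (X × X)).map Prod.snd = ν}
  have hm : Measurable fun y : X => edist x₀ y := (continuous_const.edist continuous_id).measurable
  obtain ⟨γ, hγ, hmin⟩ := exists_isMinOn_lintegral (K := K)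
    ((isClosed_setOf_map_eq continuous_fst μ).inter (isClosed_setOf_map_eq continuous_snd ν))
    (g := fun p : X × X => edist p.1 p.2) continuous_edist
    (μ₀ := ⟨μ.prod ν, inferInstance⟩)
    ⟨(measurePreserving_fst (μ := μ) (ν := ν)).map_eq,
      (measurePreserving_snd (μ := μ) (ν := ν)).map_eq⟩ (x₀, x₀)
    (D := ∫⁻ x, edist x₀ x ∂μ + ∫⁻ x, edist x₀ x ∂ν)
    -- The marginals alone bound the moment of every plan, so the cost bound is not needed.
    (ENNReal.add_ne_top.2 ⟨((mem_P1_iff x₀).1 hμ).2, ((mem_P1_iff x₀).1 hν).2⟩) (by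
      rintro γ ⟨h1, h2⟩ -
      rw [← h1, ← h2, lintegral_map hm measurable_fst, lintegral_map hm measurable_snd,
        ← lintegral_add_left (by exact hm.comp measurable_fst)]
      refine lintegral_mono fun p => ?_
      rw [Prod.edist_eq]
      exact max_le le_self_add le_add_self)
  exact ⟨γ, ⟨γ.2, hγ.1, hγ.2⟩, fun γ' hγ' => hmin ⟨γ', hγ'.1⟩ ⟨hγ'.2.1, hγ'.2.2⟩⟩

end Plans

/-! ### Gluing plans along a common marginal -/

section Gluing

/-- The product of finitely many Markov kernels with the same source. -/
noncomputable def piKernel {ι α : Type*} [Fintype ι] {β : ι → Type*} [MeasurableSpace α]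
    [∀ i, MeasurableSpace (β i)] (κ : ∀ i, Kernel α (β i)) [∀ i, IsMarkovKernel (κ i)] :
    Kernel α (∀ i, β i) where
  toFun a := Measure.pi fun i => κ i a
  measurable' := by
    refine Measurable.measure_of_isPiSystem_of_isProbabilityMeasure generateFrom_pi.symm
      isPiSystem_pi ?_
    rintro _ ⟨s, hs, rfl⟩
    simp only [Measure.pi_pi]
    exact Finset.measurable_prod _ fun i _ =>
      Kernel.measurable_coe (κ i) (hs i (Set.mem_univ i))

variable {ι α : Type*} [Fintype ι] {β : ι → Type*} [MeasurableSpace α]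
  [∀ i, MeasurableSpace (β i)]

instance (κ : ∀ i, Kernel α (β i)) [∀ i, IsMarkovKernel (κ i)] : IsMarkovKernel (piKernel κ) :=
  ⟨fun a => by
    change IsProbabilityMeasure (Measure.pi fun i => κ i a)
    infer_instance⟩

theorem piKernel_map_eval (κ : ∀ i, Kernel α (β i)) [∀ i, IsMarkovKernel (κ i)] (i : ι) :
    (piKernel κ).map (Function.eval i) = κ i := by
  ext1 a
  rw [Kernel.map_apply _ (measurable_pi_apply i)]
  exact (measurePreserving_eval (fun i => κ i a) i).map_eq

/-- Gluing of finitely many plans along a common first marginal. -/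
theorem exists_glue {μ : Measure α} [IsProbabilityMeasure μ] [∀ i, StandardBorelSpace (β i)]
    [∀ i, Nonempty (β i)] (γ : ∀ i, Measure (α × β i)) [∀ i, IsProbabilityMeasure (γ i)]
    (hγ : ∀ i, (γ i).map Prod.fst = μ) :
    ∃ θ : Measure (α × ∀ i, β i), IsProbabilityMeasure θ ∧ θ.map Prod.fst = μ ∧
      ∀ i, θ.map (fun p => (p.1, p.2 i)) = γ i := by
  -- Given the common variable, the other coordinates are drawn independently from the conditional
  -- laws of the `γ i`.
  refine ⟨μ ⊗ₘ piKernel fun i => (γ i).condKernel, inferInstance, Measure.fst_compProd _ _,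
    fun i => ?_⟩
  have h := Measure.compProd_map (μ := μ) (κ := piKernel fun i => (γ i).condKernel)
    (measurable_pi_apply i)
  have h' := (γ i).disintegrate (γ i).condKernel
  rw [Measure.fst, hγ i] at h'
  have h'' := piKernel_map_eval (fun i => (γ i).condKernel) i
  exact h.symm.trans ((congrArg (μ ⊗ₘ ·) h'').trans h')

end Gluing

end WassersteinMedian
namespace WassersteinMedian

/-! ### The pointwise costs `f` and `c` -/

section Cost

variable {X : Type*} [MetricSpace X] {N : ℕ} {w : Fin N → ℝ}

theorem f_nonneg (hw : ∀ i, 0 ≤ w i) (p : X × (Fin N → X)) : 0 ≤ f w p :=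
  Finset.sum_nonneg fun i _ => mul_nonneg (hw i) dist_nonneg

theorem continuous_f (w : Fin N → ℝ) : Continuous (f (X := X) w) := by
  unfold f
  fun_prop

theorem ofReal_f (hw : ∀ i, 0 ≤ w i) (p : X × (Fin N → X)) :
    ENNReal.ofReal (f w p) = ∑ i, ENNReal.ofReal (w i) * edist (p.2 i) p.1 := by
  rw [f, ENNReal.ofReal_sum_of_nonneg fun i _ => mul_nonneg (hw i) dist_nonneg]
  exact Finset.sum_congr rfl fun i _ => by rw [ENNReal.ofReal_mul (hw i), edist_dist]

theorem bddBelow_range_f (hw : ∀ i, 0 ≤ w i) (x : Fin N → X) :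
    BddBelow (Set.range fun y : X => f w (y, x)) :=
  ⟨0, by rintro _ ⟨y, rfl⟩; exact f_nonneg hw _⟩

theorem c_le (hw : ∀ i, 0 ≤ w i) (p : X × (Fin N → X)) : c w p.2 ≤ f w p :=
  ciInf_le (bddBelow_range_f hw p.2) p.1

theorem c_nonneg (hw : ∀ i, 0 ≤ w i) (x : Fin N → X) : 0 ≤ c w x :=
  Real.iInf_nonneg fun _ => f_nonneg hw _

theorem mem_M_iff [Nonempty X] (hw : ∀ i, 0 ≤ w i) (x : Fin N → X) (y : X) :
    y ∈ M w x ↔ f w (y, x) ≤ c w x :=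
  ⟨fun h => le_ciInf h, fun h z => h.trans (c_le hw (z, x))⟩

variable [MeasurableSpace X] [BorelSpace X] [SecondCountableTopology X]

/-- An infimum of continuous functions, even an uncountable one, is upper semicontinuous. -/
theorem measurable_c (hw : ∀ i, 0 ≤ w i) : Measurable (c (X := X) w) := by
  have h : UpperSemicontinuous (c (X := X) w) :=
    upperSemicontinuous_ciInf (f := fun y x => f w (y, x)) (bddBelow_range_f hw) fun y =>
      ((continuous_f w).comp (Continuous.prodMk_right y)).upperSemicontinuous
  exact h.measurable

/-- Almost minimizers of `f_w(·, x)` can be chosen measurably in `x`. -/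
theorem exists_measurable_f_le [Nonempty X] (hw : ∀ i, 0 ≤ w i) {ε : ℝ} (hε : 0 < ε) :
    ∃ m : (Fin N → X) → X, Measurable m ∧ ∀ x, f w (m x, x) ≤ c w x + ε := by
  classical
  -- Strict near-minimizers form a nonempty open set, which meets a dense sequence; taking the first
  -- index that works makes the choice measurable.
  have hex : ∀ x : Fin N → X, ∃ n : ℕ,
      f w (TopologicalSpace.denseSeq X n, x) < c w x + ε := by
    intro x
    obtain ⟨y, hy⟩ := exists_lt_of_ciInf_lt (lt_add_of_pos_right (c w x) hε)
    have hopen : IsOpen {y : X | f w (y, x) < c w x + ε} :=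
      isOpen_lt ((continuous_f w).comp (Continuous.prodMk_left x)) continuous_const
    obtain ⟨_, hz, n, rfl⟩ := (TopologicalSpace.denseRange_denseSeq X).inter_open_nonempty
      _ hopen ⟨y, hy⟩
    exact ⟨n, hz⟩
  refine ⟨fun x => TopologicalSpace.denseSeq X (Nat.find (hex x)), ?_, fun x =>
    (Nat.find_spec (hex x)).le⟩
  exact Measurable.find (f := fun n _ => TopologicalSpace.denseSeq X n)
    (fun n => measurable_const)
    (fun n => measurableSet_lt
      (((continuous_f w).comp (Continuous.prodMk_right _)).measurable)
      ((measurable_c hw).add_const ε)) hex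

theorem extendedCost_eq (hw : ∀ i, 0 ≤ w i) (θ : Measure (X × (Fin N → X))) :
    extendedCost w θ = ∑ i, ENNReal.ofReal (w i) * ∫⁻ p, edist (p.2 i) p.1 ∂θ := by
  have hm : ∀ i, Measurable fun p : X × (Fin N → X) => edist (p.2 i) p.1 := fun i => by fun_prop
  simp only [extendedCost, ofReal_f hw]
  rw [lintegral_finsetSum _ fun i _ => (hm i).const_mul _]
  exact Finset.sum_congr rfl fun i _ => lintegral_const_mul _ (hm i)

theorem couplingCost_map_snd_le (hw : ∀ i, 0 ≤ w i) (θ : Measure (X × (Fin N → X))) :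
    couplingCost w (θ.map Prod.snd) ≤ extendedCost w θ := by
  rw [couplingCost, lintegral_map (measurable_c hw).ennreal_ofReal measurable_snd]
  exact lintegral_mono fun p => ENNReal.ofReal_le_ofReal (c_le hw p)

end Cost

/-! ### Marginals, moments and admissibility on the extended product -/

section Marginals

variable {X : Type*} [MeasurableSpace X] {N : ℕ} {w : Fin N → ℝ} {ν : Fin N → Measure X}
  {θ : Measure (X × (Fin N → X))}

theorem isProbabilityMeasure_of_map_snd_mem_couplings (h : θ.map Prod.snd ∈ couplings ν) :
    IsProbabilityMeasure θ :=
  have := h.1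
  Measure.isProbabilityMeasure_of_map Prod.snd

theorem map_eval_snd (h : θ.map Prod.snd ∈ couplings ν) (i : Fin N) :
    θ.map (fun p => p.2 i) = ν i := by
  rw [← h.2 i, Measure.map_map (measurable_pi_apply i) measurable_snd]
  rfl

theorem map_pair_mem_plans (h : θ.map Prod.snd ∈ couplings ν) (i : Fin N) :
    θ.map (fun p => (p.1, p.2 i)) ∈ plans (θ.map Prod.fst) (ν i) := by
  have := isProbabilityMeasure_of_map_snd_mem_couplings h
  have hm : Measurable fun p : X × (Fin N → X) => (p.1, p.2 i) := by fun_prop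
  refine ⟨Measure.isProbabilityMeasure_map hm.aemeasurable, ?_, ?_⟩
  · rw [Measure.map_map measurable_fst hm]
    rfl
  · rw [Measure.map_map measurable_snd hm]
    exact map_eval_snd h i

variable [MetricSpace X] [ProperSpace X] [BorelSpace X]

theorem W1_le_W1_swap (μ ν : Measure X) : W1 μ ν ≤ W1 ν μ :=
  le_iInf₂ fun γ hγ => (iInf₂_le _ (map_swap_mem_plans hγ)).trans_eq (transportCost_map_swap γ)

theorem W1_comm (μ ν : Measure X) : W1 μ ν = W1 ν μ :=
  (W1_le_W1_swap μ ν).antisymm (W1_le_W1_swap ν μ)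

theorem transportCost_map_pair (θ : Measure (X × (Fin N → X))) (i : Fin N) :
    transportCost (θ.map (fun p => (p.1, p.2 i))) = ∫⁻ p, edist (p.2 i) p.1 ∂θ := by
  rw [transportCost, lintegral_map measurable_edist (by fun_prop)]
  simp only [edist_comm]

theorem W1_le_lintegral (h : θ.map Prod.snd ∈ couplings ν) (i : Fin N) :
    W1 (ν i) (θ.map Prod.fst) ≤ ∫⁻ p, edist (p.2 i) p.1 ∂θ := by
  rw [W1_comm, ← transportCost_map_pair]
  exact iInf₂_le _ (map_pair_mem_plans h i)

theorem dispersion_map_fst_le (hw : ∀ i, 0 ≤ w i) (h : θ.map Prod.snd ∈ couplings ν) :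
    dispersion w ν (θ.map Prod.fst) ≤ extendedCost w θ := by
  rw [extendedCost_eq hw, dispersion]
  gcongr with i
  exact W1_le_lintegral h i

theorem lintegral_edist_le_fst_add {X : Type*} [MeasurableSpace X] [MetricSpace X] [BorelSpace X]
    [SecondCountableTopology X] {ν : Fin N → Measure X} {θ : Measure (X × (Fin N → X))}
    (h : θ.map Prod.snd ∈ couplings ν) (x₀ : X) :
    ∫⁻ p, edist (x₀, fun _ : Fin N => x₀) p ∂θ ≤
      ∫⁻ p, edist x₀ p.1 ∂θ + ∑ i, ∫⁻ x, edist x₀ x ∂ν i := by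
  have hm : Measurable fun y : X => edist x₀ y := (continuous_const.edist continuous_id).measurable
  calc ∫⁻ p, edist (x₀, fun _ : Fin N => x₀) p ∂θ
      ≤ ∫⁻ p, edist x₀ p.1 + ∑ i, edist x₀ (p.2 i) ∂θ := by
        refine lintegral_mono fun p => ?_
        rw [Prod.edist_eq]
        refine max_le le_self_add (le_add_left ?_)
        rw [edist_pi_le_iff]
        exact fun i => Finset.single_le_sum (f := fun i => edist x₀ (p.2 i))
          (fun _ _ => zero_le) (Finset.mem_univ i)
    _ = _ := by
        rw [lintegral_add_left (by fun_prop), lintegral_finsetSum _ (fun i _ => by fun_prop)]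
        congr 1
        refine Finset.sum_congr rfl fun i _ => ?_
        rw [← map_eval_snd h i, lintegral_map hm (by fun_prop)]

/-- Reach `x` through `x_j`: the marginal `ν j` controls the first leg, and the cost, divided by `w
j`, controls the second. -/
theorem lintegral_edist_fst_le (hw : ∀ i, 0 ≤ w i) (h : θ.map Prod.snd ∈ couplings ν) (x₀ : X)
    {j : Fin N} (hj : 0 < w j) :
    ∫⁻ p, edist x₀ p.1 ∂θ ≤
      ∫⁻ x, edist x₀ x ∂ν j + (ENNReal.ofReal (w j))⁻¹ * extendedCost w θ := by
  have hm : Measurable fun y : X => edist x₀ y := (continuous_const.edist continuous_id).measurable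
  have hj0 : ENNReal.ofReal (w j) ≠ 0 := by simpa using hj
  calc ∫⁻ p, edist x₀ p.1 ∂θ ≤ ∫⁻ p, edist x₀ (p.2 j) + edist (p.2 j) p.1 ∂θ :=
        lintegral_mono fun p => edist_triangle _ _ _
    _ = ∫⁻ x, edist x₀ x ∂ν j + ∫⁻ p, edist (p.2 j) p.1 ∂θ := by
        rw [lintegral_add_left (by fun_prop), ← map_eval_snd h j, lintegral_map hm (by fun_prop)]
    _ ≤ _ := by
        gcongr
        rw [mul_comm, ← div_eq_mul_inv, ENNReal.le_div_iff_mul_le (.inl hj0)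
          (.inl ENNReal.ofReal_ne_top), mul_comm, extendedCost_eq hw]
        exact Finset.single_le_sum
          (f := fun i => ENNReal.ofReal (w i) * ∫⁻ p, edist (p.2 i) p.1 ∂θ)
          (fun _ _ => zero_le) (Finset.mem_univ j)

theorem fst_mem_P1 (h : θ ∈ P1 (X × (Fin N → X))) : θ.map Prod.fst ∈ P1 X := by
  have := h.1
  obtain ⟨p⟩ := nonempty_of_isProbabilityMeasure θ
  have hm : Measurable fun y : X => edist p.1 y :=
    (continuous_const.edist continuous_id).measurable
  refine (mem_P1_iff p.1).2 ⟨Measure.isProbabilityMeasure_map measurable_fst.aemeasurable, ?_⟩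
  rw [lintegral_map hm measurable_fst]
  refine ne_top_of_le_ne_top ((mem_P1_iff p).1 h).2 (lintegral_mono fun q => ?_)
  rw [Prod.edist_eq]
  exact le_max_left _ _

theorem mem_extendedCouplings_of_fst_mem_P1 (hν : ∀ i, ν i ∈ P1 X)
    (h : θ.map Prod.snd ∈ couplings ν) (h1 : θ.map Prod.fst ∈ P1 X) :
    θ ∈ extendedCouplings ν := by
  have hθ := isProbabilityMeasure_of_map_snd_mem_couplings h
  obtain ⟨x₀, -⟩ := nonempty_of_isProbabilityMeasure θ
  have hm : Measurable fun y : X => edist x₀ y := (continuous_const.edist continuous_id).measurable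
  refine ⟨(mem_P1_iff (x₀, fun _ => x₀)).2 ⟨hθ, ?_⟩, h⟩
  refine ne_top_of_le_ne_top ?_ (lintegral_edist_le_fst_add h x₀)
  rw [← lintegral_map hm measurable_fst]
  exact ENNReal.add_ne_top.2 ⟨((mem_P1_iff x₀).1 h1).2,
    ENNReal.sum_ne_top.2 fun i _ => ((mem_P1_iff x₀).1 (hν i)).2⟩

/-- Lets competitors be built from marginals and cost alone: finite cost already forces a finite
first moment. -/
theorem mem_extendedCouplings_of_extendedCost_ne_top (hw : ∀ i, 0 ≤ w i) {j : Fin N}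
    (hj : 0 < w j) (hν : ∀ i, ν i ∈ P1 X) (h : θ.map Prod.snd ∈ couplings ν)
    (hc : extendedCost w θ ≠ ∞) : θ ∈ extendedCouplings ν := by
  have hθ := isProbabilityMeasure_of_map_snd_mem_couplings h
  obtain ⟨x₀, -⟩ := nonempty_of_isProbabilityMeasure θ
  have hm : Measurable fun y : X => edist x₀ y := (continuous_const.edist continuous_id).measurable
  refine mem_extendedCouplings_of_fst_mem_P1 hν h
    ((mem_P1_iff x₀).2 ⟨Measure.isProbabilityMeasure_map measurable_fst.aemeasurable, ?_⟩)
  rw [lintegral_map hm measurable_fst]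
  refine ne_top_of_le_ne_top ?_ (lintegral_edist_fst_le hw h x₀ hj)
  exact ENNReal.add_ne_top.2 ⟨((mem_P1_iff x₀).1 (hν j)).2,
    ENNReal.mul_ne_top (by simpa using hj) hc⟩

theorem extendedCost_ne_top (hw : ∀ i, 0 ≤ w i) (h : θ ∈ extendedCouplings ν) :
    extendedCost w θ ≠ ∞ := by
  have := h.1.1
  obtain ⟨x₀, -⟩ := nonempty_of_isProbabilityMeasure θ
  rw [extendedCost_eq hw]
  refine ENNReal.sum_ne_top.2 fun i _ => ENNReal.mul_ne_top ENNReal.ofReal_ne_top ?_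
  refine ne_top_of_le_ne_top (b := ∫⁻ p, 2 * edist (x₀, fun _ : Fin N => x₀) p ∂θ) ?_
    (lintegral_mono fun p => ?_)
  · rw [lintegral_const_mul _ (by exact (continuous_const.edist continuous_id).measurable)]
    exact ENNReal.mul_ne_top (by simp) ((mem_P1_iff _).1 h.1).2
  · have h1 : edist x₀ p.1 ≤ edist (x₀, fun _ : Fin N => x₀) p := le_max_left _ _
    have h2 : edist x₀ (p.2 i) ≤ edist (x₀, fun _ : Fin N => x₀) p :=
      (edist_le_pi_edist (fun _ => x₀) p.2 i).trans (le_max_right _ _)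
    calc edist (p.2 i) p.1 ≤ edist x₀ (p.2 i) + edist x₀ p.1 := edist_triangle_left _ _ _
      _ ≤ _ := by rw [two_mul]; exact add_le_add h2 h1

end Marginals

/-! ### Existence for (B), and comparison with (A) and (C) -/

section Problems

variable {X : Type*} [MetricSpace X] [ProperSpace X] [MeasurableSpace X] [BorelSpace X]
  {N : ℕ} {w : Fin N → ℝ} {ν : Fin N → Measure X}

theorem extendedCouplings_nonempty [Nonempty X] (hν : ∀ i, ν i ∈ P1 X) :
    (extendedCouplings ν).Nonempty := by
  have := fun i => (hν i).1
  let x₀ : X := Classical.arbitrary X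
  refine ⟨(Measure.dirac x₀).prod (Measure.pi ν), mem_extendedCouplings_of_fst_mem_P1 hν ?_ ?_⟩
  · rw [(measurePreserving_snd (μ := Measure.dirac x₀) (ν := Measure.pi ν)).map_eq]
    exact ⟨inferInstance, fun i => (measurePreserving_eval ν i).map_eq⟩
  · rw [(measurePreserving_fst (μ := Measure.dirac x₀) (ν := Measure.pi ν)).map_eq]
    refine (mem_P1_iff x₀).2 ⟨inferInstance, ?_⟩
    simp

theorem exists_solvesExtended [Nonempty X] (hw : ∀ i, 0 ≤ w i) {j : Fin N} (hj : 0 < w j)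
    (hν : ∀ i, ν i ∈ P1 X) : ∃ θ, SolvesExtended w ν θ := by
  have := fun i => (hν i).1
  obtain ⟨θ₀, h₀⟩ := extendedCouplings_nonempty hν
  let x₀ : X := Classical.arbitrary X
  -- The first-moment condition is dropped here, leaving only weakly closed constraints; the
  -- minimizer recovers it from its finite cost.
  let K : Set (ProbabilityMeasure (X × (Fin N → X))) :=
    ⋂ i, {θ | (θ : Measure (X × (Fin N → X))).map (fun p => p.2 i) = ν i}
  have hK : ∀ θ : ProbabilityMeasure (X × (Fin N → X)),
      θ ∈ K ↔ (θ : Measure (X × (Fin N → X))).map Prod.snd ∈ couplings ν := by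
    intro θ
    rw [Set.mem_iInter]
    refine ⟨fun h => ⟨Measure.isProbabilityMeasure_map measurable_snd.aemeasurable, fun i => ?_⟩,
      fun h i => map_eval_snd h i⟩
    rw [Measure.map_map (measurable_pi_apply i) measurable_snd]
    exact h i
  obtain ⟨θ, hθ, hmin⟩ := exists_isMinOn_lintegral (K := K)
    (isClosed_iInter fun i => isClosed_setOf_map_eq (by fun_prop) (ν i))
    (g := fun p => ENNReal.ofReal (f w p)) (ENNReal.continuous_ofReal.comp (continuous_f w))
    (μ₀ := ⟨θ₀, h₀.1.1⟩) ((hK ⟨θ₀, h₀.1.1⟩).2 h₀.2) (x₀, fun _ => x₀)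
    (D := ∫⁻ x, edist x₀ x ∂ν j + (ENNReal.ofReal (w j))⁻¹ * extendedCost w θ₀ +
      ∑ i, ∫⁻ x, edist x₀ x ∂ν i)
    (ENNReal.add_ne_top.2 ⟨ENNReal.add_ne_top.2 ⟨((mem_P1_iff x₀).1 (hν j)).2,
      ENNReal.mul_ne_top (by simpa using hj) (extendedCost_ne_top hw h₀)⟩,
      ENNReal.sum_ne_top.2 fun i _ => ((mem_P1_iff x₀).1 (hν i)).2⟩) (by
      intro θ hθ hle
      refine (lintegral_edist_le_fst_add ((hK θ).1 hθ) x₀).trans ?_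
      gcongr
      refine (lintegral_edist_fst_le hw ((hK θ).1 hθ) x₀ hj).trans ?_
      gcongr
      exact hle)
  have hmin' : ∀ θ' ∈ extendedCouplings ν,
      extendedCost w (θ : Measure (X × (Fin N → X))) ≤ extendedCost w θ' :=
    fun θ' hθ' => hmin ⟨θ', hθ'.1.1⟩ ((hK ⟨θ', hθ'.1.1⟩).2 hθ'.2)
  exact ⟨θ, mem_extendedCouplings_of_extendedCost_ne_top hw hj hν ((hK θ).1 hθ)
    (ne_top_of_le_ne_top (extendedCost_ne_top hw h₀) (hmin' θ₀ h₀)), fun θ' hθ' => hmin' θ' hθ'⟩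

theorem exists_extendedCost_eq_dispersion (hw : ∀ i, 0 ≤ w i) (hν : ∀ i, ν i ∈ P1 X)
    {μ : Measure X} (hμ : μ ∈ P1 X) :
    ∃ θ ∈ extendedCouplings ν, θ.map Prod.fst = μ ∧ extendedCost w θ = dispersion w ν μ := by
  have := hμ.1
  have := nonempty_of_isProbabilityMeasure μ
  choose γ hγ using fun i => exists_isOptimalPlan hμ (hν i)
  have := fun i => (hγ i).1.1
  obtain ⟨θ, hθ, h1, hp⟩ := exists_glue γ fun i => (hγ i).1.2.1
  have hc : θ.map Prod.snd ∈ couplings ν := by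
    refine ⟨Measure.isProbabilityMeasure_map measurable_snd.aemeasurable, fun i => ?_⟩
    rw [← (hγ i).1.2.2, ← hp i, Measure.map_map (measurable_pi_apply i) measurable_snd,
      Measure.map_map measurable_snd (by fun_prop)]
    rfl
  refine ⟨θ, mem_extendedCouplings_of_fst_mem_P1 hν hc (h1 ▸ hμ), h1, ?_⟩
  rw [extendedCost_eq hw, dispersion]
  refine Finset.sum_congr rfl fun i _ => ?_
  rw [← transportCost_map_pair, hp i, (hγ i).transportCost_eq, W1_comm]

/-- Pushing `γ` forward by `x ↦ (m x, x)`, with `m` an `ε`-minimizing selection, gives a competitor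
for (B) at extra cost at most `ε`. No exact measurable selection is required. -/
theorem extendedCost_le_couplingCost [Nonempty X] (hw : ∀ i, 0 ≤ w i) {j : Fin N} (hj : 0 < w j)
    (hν : ∀ i, ν i ∈ P1 X) {θ : Measure (X × (Fin N → X))} (hθ : SolvesExtended w ν θ)
    {γ : Measure (Fin N → X)} (hγ : γ ∈ couplings ν) : extendedCost w θ ≤ couplingCost w γ := by
  have := hγ.1
  refine ENNReal.le_of_forall_pos_le_add fun ε hε hfin => ?_
  obtain ⟨m, hm, hmc⟩ := exists_measurable_f_le (X := X) hw (ε := ε) (by exact_mod_cast hε)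
  have hmm : Measurable fun x => (m x, x) := hm.prodMk measurable_id
  have hs : (γ.map fun x => (m x, x)).map Prod.snd = γ := by
    rw [Measure.map_map measurable_snd hmm]
    exact Measure.map_id
  have hcost : extendedCost w (γ.map fun x => (m x, x)) ≤ couplingCost w γ + ε := by
    rw [extendedCost, lintegral_map (continuous_f w).measurable.ennreal_ofReal hmm]
    calc ∫⁻ x, ENNReal.ofReal (f w (m x, x)) ∂γ
        ≤ ∫⁻ x, ENNReal.ofReal (c w x) + ε ∂γ := by
          refine lintegral_mono fun x => (ENNReal.ofReal_le_ofReal (hmc x)).trans ?_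
          rw [ENNReal.ofReal_add (c_nonneg hw x) ε.coe_nonneg, ENNReal.ofReal_coe_nnreal]
      _ = couplingCost w γ + ε := by
          rw [lintegral_add_right _ measurable_const]
          simp [couplingCost]
  refine le_trans (hθ.2 <| mem_extendedCouplings_of_extendedCost_ne_top hw hj hν
    (hs.symm ▸ hγ) ?_) hcost
  exact ne_top_of_le_ne_top (ENNReal.add_ne_top.2 ⟨hfin.ne, ENNReal.coe_ne_top⟩) hcost

end Problems

end WassersteinMedian
namespace WassersteinMedian

/-! ### Structure of solutions and the disintegration criterion -/

section Solutions

variable {X : Type*} [MetricSpace X] [ProperSpace X] [MeasurableSpace X] [BorelSpace X]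
  {N : ℕ} {w : Fin N → ℝ} {ν : Fin N → Measure X} {θ : Measure (X × (Fin N → X))}

theorem SolvesExtended.extendedCost_eq_dispersion (hw : ∀ i, 0 ≤ w i) (hν : ∀ i, ν i ∈ P1 X)
    (h : SolvesExtended w ν θ) : extendedCost w θ = dispersion w ν (θ.map Prod.fst) := by
  obtain ⟨θ', hθ', -, hc⟩ := exists_extendedCost_eq_dispersion hw hν (fst_mem_P1 h.1.1)
  exact ((h.2 hθ').trans_eq hc).antisymm (dispersion_map_fst_le hw h.1.2)

theorem SolvesExtended.map_fst_mem_Med (hw : ∀ i, 0 ≤ w i) (hν : ∀ i, ν i ∈ P1 X)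
    (h : SolvesExtended w ν θ) : θ.map Prod.fst ∈ Med w ν := by
  refine ⟨fst_mem_P1 h.1.1, fun μ hμ => ?_⟩
  obtain ⟨θ', hθ', -, hc⟩ := exists_extendedCost_eq_dispersion hw hν hμ
  exact (dispersion_map_fst_le hw h.1.2).trans ((h.2 hθ').trans_eq hc)

theorem exists_solvesExtended_of_mem_Med (hw : ∀ i, 0 ≤ w i) (hν : ∀ i, ν i ∈ P1 X)
    {μ : Measure X} (hμ : μ ∈ Med w ν) : ∃ θ, SolvesExtended w ν θ ∧ μ = θ.map Prod.fst := by
  obtain ⟨θ, hθ, h1, hc⟩ := exists_extendedCost_eq_dispersion hw hν hμ.1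
  exact ⟨θ, ⟨hθ, fun θ' hθ' => hc.trans_le
    ((hμ.2 (fst_mem_P1 hθ'.1)).trans (dispersion_map_fst_le hw hθ'.2))⟩, h1.symm⟩

theorem SolvesExtended.isOptimalPlan (hw : ∀ i, 0 ≤ w i) (hν : ∀ i, ν i ∈ P1 X)
    (h : SolvesExtended w ν θ) {j : Fin N} (hj : 0 < w j) :
    IsOptimalPlan (θ.map (fun p => (p.1, p.2 j))) (θ.map Prod.fst) (ν j) := by
  refine ⟨map_pair_mem_plans h.1.2 j, ?_⟩
  suffices h' : transportCost (θ.map (fun p => (p.1, p.2 j))) ≤ W1 (θ.map Prod.fst) (ν j) from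
    fun γ hγ => h'.trans (iInf₂_le γ hγ)
  rw [transportCost_map_pair, W1_comm]
  have heq := h.extendedCost_eq_dispersion hw hν
  have hfin := extendedCost_ne_top hw h.1
  rw [extendedCost_eq hw] at heq hfin
  rw [dispersion, ← Finset.add_sum_erase _ _ (Finset.mem_univ j),
    ← Finset.add_sum_erase _ _ (Finset.mem_univ j)] at heq
  -- The total costs agree and each term dominates its `W1` counterpart. Finiteness of the other
  -- terms allows cancelling them, and then the positive weight `w j`.
  have hrest : ∑ i ∈ Finset.univ.erase j, ENNReal.ofReal (w i) * ∫⁻ p, edist (p.2 i) p.1 ∂θ ≠ ∞ :=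
    ne_top_of_le_ne_top hfin (Finset.sum_le_sum_of_subset (Finset.erase_subset _ _))
  have hle := heq.trans_le (add_le_add_right (Finset.sum_le_sum fun i _ =>
    mul_le_mul_right (W1_le_lintegral h.1.2 i) (ENNReal.ofReal (w i))) _)
  exact (ENNReal.mul_le_mul_iff_right (by simpa using hj) ENNReal.ofReal_ne_top).1
    ((ENNReal.add_le_add_iff_right hrest).1 hle)

theorem SolvesExtended.solvesCoupling [Nonempty X] (hw : ∀ i, 0 ≤ w i) {j : Fin N}
    (hj : 0 < w j) (hν : ∀ i, ν i ∈ P1 X) (h : SolvesExtended w ν θ) :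
    SolvesCoupling w ν (θ.map Prod.snd) :=
  ⟨h.1.2, fun _ hγ => (couplingCost_map_snd_le hw θ).trans
    (extendedCost_le_couplingCost hw hj hν h hγ)⟩

theorem SolvesExtended.couplingCost_map_snd [Nonempty X] (hw : ∀ i, 0 ≤ w i) {j : Fin N}
    (hj : 0 < w j) (hν : ∀ i, ν i ∈ P1 X) (h : SolvesExtended w ν θ) :
    couplingCost w (θ.map Prod.snd) = extendedCost w θ :=
  (couplingCost_map_snd_le hw θ).antisymm (extendedCost_le_couplingCost hw hj hν h h.1.2)

theorem measurableSet_setOf_mem_M [Nonempty X] (hw : ∀ i, 0 ≤ w i) :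
    MeasurableSet {p : (Fin N → X) × X | p.2 ∈ M w p.1} := by
  simp only [mem_M_iff hw]
  exact measurableSet_le (((continuous_f w).comp continuous_swap).measurable)
    ((measurable_c hw).comp measurable_fst)

theorem measurableSet_M [Nonempty X] (hw : ∀ i, 0 ≤ w i) (x : Fin N → X) :
    MeasurableSet (M w x) :=
  measurable_prodMk_left (measurableSet_setOf_mem_M hw)

/-- Since `c ≤ f` pointwise and both have the same finite integral, they agree almost everywhere. -/
theorem SolvesExtended.ae_mem_M [Nonempty X] (hw : ∀ i, 0 ≤ w i) {j : Fin N}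
    (hj : 0 < w j) (hν : ∀ i, ν i ∈ P1 X) (h : SolvesExtended w ν θ) :
    ∀ᵐ p ∂θ, p.1 ∈ M w p.2 := by
  have hc := h.couplingCost_map_snd hw hj hν
  have hfin := extendedCost_ne_top hw h.1
  rw [← hc] at hfin
  rw [couplingCost, lintegral_map (measurable_c hw).ennreal_ofReal measurable_snd] at hc hfin
  filter_upwards [ae_eq_of_ae_le_of_lintegral_le
    (ae_of_all _ fun p => ENNReal.ofReal_le_ofReal (c_le hw p)) hfin
    (continuous_f w).measurable.ennreal_ofReal.aemeasurable hc.ge] with p hp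
  rw [mem_M_iff hw]
  exact ((ENNReal.ofReal_eq_ofReal_iff (c_nonneg hw _) (f_nonneg hw _)).1 hp).ge

theorem disintegrated_condKernel [Nonempty X] (θ : Measure (X × (Fin N → X)))
    [IsFiniteMeasure θ] :
    disintegrated (θ.map Prod.snd) (θ.map Prod.swap).condKernel = θ := by
  have h : (θ.map Prod.swap).fst = θ.map Prod.snd := by
    rw [Measure.fst, Measure.map_map measurable_fst measurable_swap]
    rfl
  rw [disintegrated, ← h, Measure.disintegrate, Measure.map_map measurable_swap measurable_swap,
    Prod.swap_swap_eq, Measure.map_id]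

theorem map_snd_disintegrated {X : Type*} [MeasurableSpace X] (γ : Measure (Fin N → X))
    [SFinite γ] (κ : Kernel (Fin N → X) X) [IsMarkovKernel κ] :
    (disintegrated γ κ).map Prod.snd = γ := by
  rw [disintegrated, Measure.map_map measurable_snd measurable_swap]
  exact Measure.fst_compProd γ κ

theorem extendedCost_disintegrated_le [Nonempty X] (hw : ∀ i, 0 ≤ w i) (γ : Measure (Fin N → X))
    [SFinite γ] (κ : Kernel (Fin N → X) X) [IsMarkovKernel κ]
    (hκ : ∀ᵐ x ∂γ, κ x (M w x)ᶜ = 0) :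
    extendedCost w (disintegrated γ κ) ≤ couplingCost w γ := by
  have hm : Measurable fun p => ENNReal.ofReal (f (X := X) (N := N) w p) :=
    (continuous_f w).measurable.ennreal_ofReal
  rw [extendedCost, disintegrated, lintegral_map hm measurable_swap,
    Measure.lintegral_compProd (by exact hm.comp measurable_swap)]
  refine lintegral_mono_ae ?_
  filter_upwards [hκ] with x hx
  calc ∫⁻ y, ENNReal.ofReal (f w (y, x)) ∂κ x ≤ ∫⁻ _, ENNReal.ofReal (c w x) ∂κ x := by
        refine lintegral_mono_ae ?_
        filter_upwards [measure_eq_zero_iff_ae_notMem.1 hx] with y hy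
        exact ENNReal.ofReal_le_ofReal ((mem_M_iff hw x y).1 (not_not.1 hy))
    _ = ENNReal.ofReal (c w x) := by simp

/-- On pointwise medians `f` equals `c`, so the cost is at most the (C)-value of `γ`, a lower bound
for (B). -/
theorem SolvesCoupling.solvesExtended_disintegrated [Nonempty X] (hw : ∀ i, 0 ≤ w i) {j : Fin N}
    (hj : 0 < w j) (hν : ∀ i, ν i ∈ P1 X) {γ : Measure (Fin N → X)} (hγ : SolvesCoupling w ν γ)
    (κ : Kernel (Fin N → X) X) [IsMarkovKernel κ] (hκ : ∀ᵐ x ∂γ, κ x (M w x)ᶜ = 0) :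
    SolvesExtended w ν (disintegrated γ κ) := by
  have := hγ.1.1
  have hle := extendedCost_disintegrated_le hw γ κ hκ
  have hmin : ∀ θ' ∈ extendedCouplings ν, extendedCost w (disintegrated γ κ) ≤ extendedCost w θ' :=
    fun θ' hθ' => hle.trans ((hγ.2 hθ'.2).trans (couplingCost_map_snd_le hw θ'))
  obtain ⟨θ₀, h₀⟩ := extendedCouplings_nonempty hν
  exact ⟨mem_extendedCouplings_of_extendedCost_ne_top hw hj hν
    ((map_snd_disintegrated γ κ).symm ▸ hγ.1)
    (ne_top_of_le_ne_top (extendedCost_ne_top hw h₀) (hmin θ₀ h₀)), hmin⟩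

theorem map_fst_disintegrated_deterministic {X : Type*} [MeasurableSpace X] 
    (γ : Measure (Fin N → X)) [SFinite γ] {m : (Fin N → X) → X} (hm : Measurable m) :
    (disintegrated γ (Kernel.deterministic m hm)).map Prod.fst = γ.map m := by
  rw [disintegrated, Measure.compProd_deterministic, Measure.map_map measurable_swap (by fun_prop),
    Measure.map_map measurable_fst (by fun_prop)]
  rfl

theorem mem_Med_iff [Nonempty X] (hw : ∀ i, 0 ≤ w i) {j : Fin N} (hj : 0 < w j)
    (hν : ∀ i, ν i ∈ P1 X) (μ : Measure X) :
    μ ∈ Med w ν ↔ ∃ γ, SolvesCoupling w ν γ ∧ ∃ κ : Kernel (Fin N → X) X, IsMarkovKernel κ ∧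
      (∀ᵐ x ∂γ, κ x (M w x)ᶜ = 0) ∧ μ = (disintegrated γ κ).map Prod.fst := by
  constructor
  · intro hμ
    obtain ⟨θ, hθ, rfl⟩ := exists_solvesExtended_of_mem_Med hw hν hμ
    have := hθ.1.1.1
    have hd := disintegrated_condKernel θ
    have hM := hθ.ae_mem_M hw hj hν
    have := hθ.1.2.1
    refine ⟨θ.map Prod.snd, hθ.solvesCoupling hw hj hν, (θ.map Prod.swap).condKernel,
      inferInstance, ?_, by rw [hd]⟩
    -- Writing `θ` in disintegrated form turns concentration on medians into a statement about
    -- almost every conditional law.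
    nth_rw 1 [← hd] at hM
    exact (Measure.ae_compProd_iff (measurableSet_setOf_mem_M hw)).1
      (ae_of_ae_map measurable_swap.aemeasurable hM)
  · rintro ⟨γ, hγ, κ, hκ, hM, rfl⟩
    exact (hγ.solvesExtended_disintegrated hw hj hν κ hM).map_fst_mem_Med hw hν

end Solutions

end WassersteinMedian

theorem mainTheorem6 {X : Type*} [MetricSpace X] [ProperSpace X] [MeasurableSpace X] [BorelSpace X]
    {N : ℕ} (w : Fin N → ℝ) (hw : w ∈ stdSimplex ℝ (Fin N))
    (ν : Fin N → Measure X) (hν : ∀ i, ν i ∈ WassersteinMedian.P1 X) :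
    -- the three minima are attained, finite and equal
    (∃ v : ℝ≥0,
      IsLeast (WassersteinMedian.dispersion w ν '' WassersteinMedian.P1 X) (v : ℝ≥0∞) ∧
      IsLeast (WassersteinMedian.extendedCost w '' WassersteinMedian.extendedCouplings ν)
        (v : ℝ≥0∞) ∧
      IsLeast (WassersteinMedian.couplingCost w '' WassersteinMedian.couplings ν) (v : ℝ≥0∞)) ∧
    -- medians are the first marginals of solutions
    (∀ μ ∈ WassersteinMedian.Med w ν,
      ∃ θ, WassersteinMedian.SolvesExtended w ν θ ∧ μ = θ.map Prod.fst) ∧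
    (∀ θ, WassersteinMedian.SolvesExtended w ν θ →
      θ.map Prod.fst ∈ WassersteinMedian.Med w ν) ∧
    -- pairwise projections are optimal plans
    (∀ θ, WassersteinMedian.SolvesExtended w ν θ → ∀ j, 0 < w j →
      WassersteinMedian.IsOptimalPlan (θ.map (fun p => (p.1, p.2 j))) (θ.map Prod.fst) (ν j)) ∧
    -- push-forward by a Borel selection of the pointwise medians
    (∀ m : (Fin N → X) → X, Measurable m → (∀ x, m x ∈ WassersteinMedian.M w x) →
      ∀ γ, WassersteinMedian.SolvesCoupling w ν γ → γ.map m ∈ WassersteinMedian.Med w ν) ∧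
    -- characterization of medians by disintegration
    (∀ μ : Measure X, μ ∈ WassersteinMedian.Med w ν ↔
      ∃ γ, WassersteinMedian.SolvesCoupling w ν γ ∧
        ∃ κ : Kernel (Fin N → X) X, IsMarkovKernel κ ∧
          (∀ᵐ x ∂γ, κ x (WassersteinMedian.M w x)ᶜ = 0) ∧
          μ = (WassersteinMedian.disintegrated γ κ).map Prod.fst) := by
  obtain ⟨hw0, hw1⟩ := hw
  -- The weights sum to `1`, so one is positive; its `ν j` also shows that `X` is nonempty.
  obtain ⟨j, -, hj⟩ : ∃ j ∈ Finset.univ, 0 < w j :=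
    Finset.exists_lt_of_sum_lt (by simp [hw1])
  have := (hν j).1
  have := nonempty_of_isProbabilityMeasure (ν j)
  refine ⟨?_, fun μ hμ => WassersteinMedian.exists_solvesExtended_of_mem_Med hw0 hν hμ,
    fun θ hθ => hθ.map_fst_mem_Med hw0 hν, fun θ hθ j hj => hθ.isOptimalPlan hw0 hν hj,
    fun m hm hM γ hγ => ?_, WassersteinMedian.mem_Med_iff hw0 hj hν⟩
  · obtain ⟨θ, hθ⟩ := WassersteinMedian.exists_solvesExtended hw0 hj hν
    have hmed := hθ.map_fst_mem_Med hw0 hν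
    refine ⟨(WassersteinMedian.extendedCost w θ).toNNReal, ?_⟩
    rw [ENNReal.coe_toNNReal (WassersteinMedian.extendedCost_ne_top hw0 hθ.1)]
    refine ⟨⟨⟨_, hmed.1, (hθ.extendedCost_eq_dispersion hw0 hν).symm⟩, ?_⟩,
      ⟨⟨θ, hθ.1, rfl⟩, ?_⟩, ⟨⟨_, hθ.1.2, hθ.couplingCost_map_snd hw0 hj hν⟩, ?_⟩⟩
    · rintro _ ⟨μ, hμ, rfl⟩
      exact (hθ.extendedCost_eq_dispersion hw0 hν).trans_le (hmed.2 hμ)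
    · rintro _ ⟨θ', hθ', rfl⟩
      exact hθ.2 hθ'
    · rintro _ ⟨γ, hγ, rfl⟩
      exact WassersteinMedian.extendedCost_le_couplingCost hw0 hj hν hθ hγ
  · have := hγ.1.1
    -- A Borel selection is the special case of Dirac conditional laws.
    rw [← WassersteinMedian.map_fst_disintegrated_deterministic γ hm]
    refine (hγ.solvesExtended_disintegrated hw0 hj hν _ (ae_of_all _ fun x => ?_)).map_fst_mem_Med
      hw0 hν
    rw [Kernel.deterministic_apply, Measure.dirac_apply' _
      (WassersteinMedian.measurableSet_M hw0 x).compl]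
    exact Set.indicator_of_notMem (Set.notMem_compl_iff.2 (hM x)) _
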